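/- Let $d\ge 2$ be an integer and $\omega=e^{2\pi i/d}$, and index the rows and columns of $d\times d$ matrices by $\mathbb{Z}_d$. Let $S$ be the cyclic shift matrix, $S_{jk}=\delta_{j,k+1}$, and $\Omega$ the modulation matrix, $\Omega_{jk}=\omega^{j}\delta_{jk}$. Let $T:\mathbb{C}^{\mathbb{Z}_d\times\mathbb{Z}_d}\to\mathbb{C}^{\mathbb{Z}_d\times\mathbb{Z}_d}$ be the linear operator (the reconstruction operator, or projective Fourier transform of $\mathbb{Z}_d\times\mathbb{Z}_d$) given by $$Tc=\frac1d\sum_{j,k\in\mathbb{Z}_d}c_{jk}\,(S^j\Omega^k)^*,$$ where $^*$ denotes the conjugate transpose. Then $\sqrt d\,T$ has finite order; more precisely, $$(\sqrt d\,T)^{6d}=(-1)^{\frac12 d(d-1)}I,$$ where powers are taken under composition and $I$ is the identity operator. -/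

import Mathlib

open scoped Matrix

noncomputable section

namespace WeylHeisenberg

/-- The primitive `d`-th root of unity `ω = exp (2πi/d)`. -/
def omega (d : ℕ) : ℂ := Complex.exp (2 * Real.pi * Complex.I / d)

/-- The cyclic shift matrix, `S j k = δ_{j, k+1}`, with indices in `ℤ_d`. -/
def shift (d : ℕ) : Matrix (ZMod d) (ZMod d) ℂ :=
  Matrix.of fun j k => if j = k + 1 then 1 else 0

/-- The modulation matrix, `Ω j k = ω^j δ_{j, k}`, with indices in `ℤ_d`. Since `ω^d = 1`,
the power `ω^j` may be computed with the representative `j.val` of `j`. -/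
def modulation (d : ℕ) : Matrix (ZMod d) (ZMod d) ℂ :=
  Matrix.diagonal fun j => omega d ^ j.val

/-- The unitary matrices `ρ (j, k) = S^j Ω^k` of the projective representation of `ℤ_d × ℤ_d`.
Since `S^d = Ω^d = 1`, the powers may be computed with the representatives `j.val`, `k.val`. -/
def rho (d : ℕ) [NeZero d] (g : ZMod d × ZMod d) : Matrix (ZMod d) (ZMod d) ℂ :=
  shift d ^ g.1.val * modulation d ^ g.2.val

/-- The reconstruction operator (the projective Fourier transform of `ℤ_d × ℤ_d`):
the linear operator `T c = (1/d) ∑_{j,k} c_{jk} (S^j Ω^k)^*` on `ℂ^{ℤ_d × ℤ_d}`. -/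
def reconstruction (d : ℕ) [NeZero d] : Module.End ℂ (Matrix (ZMod d) (ZMod d) ℂ) where
  toFun c := (1 / (d : ℂ)) • ∑ j : ZMod d, ∑ k : ZMod d, c j k • (rho d (j, k))ᴴ
  map_add' c c' := by
    simp only [Matrix.add_apply, add_smul, Finset.sum_add_distrib, smul_add]
  map_smul' a c := by
    simp only [Matrix.smul_apply, smul_eq_mul, mul_smul, ← Finset.smul_sum, RingHom.id_apply]
    rw [smul_comm]

end WeylHeisenberg

end

/-! Let `F` be the Fourier matrix of `ℤ_d`. Entrywise multiplication by `F` turns `T³` into left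
multiplication by `d⁻² D² F`, up to negation of the column index, where `D² = diag (ω ^ a²)`. If
the square root `D` is chosen so that its entries satisfy `χ (a + b) = χ a χ b ω ^ (a b)`, then with
the Gauss sum `g = tr D` the braid relation `D F D F D = g F⁻` holds, where `F⁻` is `d` times the
inverse of `F`, and so `(D² F)²` is conjugate to `g² D⁻²`. Since `D ^ (2 d) = 1`, this gives
`(D² F) ^ (2 d) = g ^ (2 d)`, hence `T ^ (6 d)` is scalar. The Gauss sum itself need not be
evaluated: its power `g ^ (2 d)` is read off from the determinants of the two conjugate matrices,
which involve only `det D ^ 6`, the sign of the permutation `a ↦ -a` and `det F ^ 2 = ± d ^ d`. -/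

namespace WeylHeisenberg

open Matrix ZMod

section Chirp

variable {R K : Type*} [CommRing R] [Field K] {ψ : AddChar R K} {χ : R → K}

/-- The unnormalized Fourier matrix `(ψ (a b))` of an additive character `ψ` of a ring. -/
def fourierMatrix (ψ : AddChar R K) : Matrix R R K := Matrix.of fun a b => ψ (a * b)

theorem fourierMatrix_apply (a b : R) : fourierMatrix ψ a b = ψ (a * b) := rfl

theorem fourierMatrix_inv : fourierMatrix ψ⁻¹ = (fourierMatrix ψ).submatrix (Equiv.neg R) id := by
  ext a b
  simp only [fourierMatrix_apply, submatrix_apply, AddChar.inv_apply, Equiv.neg_apply, id,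
    neg_mul]

/-- A chirp of `ψ`: a square root `χ` of the quadratic character `a ↦ ψ (a ^ 2)`, chosen so that
its polarization is the bicharacter `(a, b) ↦ ψ (a b)`. -/
structure IsChirp (ψ : AddChar R K) (χ : R → K) : Prop where
  map_add (a b : R) : χ (a + b) = χ a * χ b * ψ (a * b)
  mul_self (a : R) : χ a * χ a = ψ (a * a)

theorem IsChirp.ne_zero (hχ : IsChirp ψ χ) (a : R) : χ a ≠ 0 := by
  intro h
  have := hχ.mul_self a
  rw [h, zero_mul] at this
  exact (ψ.val_isUnit (a * a)).ne_zero this.symm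

theorem IsChirp.map_zero (hχ : IsChirp ψ χ) : χ 0 = 1 := by
  have h := hχ.map_add 0 0
  rw [add_zero, mul_zero, AddChar.map_zero_eq_one, mul_one] at h
  exact (mul_eq_left₀ (hχ.ne_zero 0)).1 h.symm

theorem IsChirp.map_neg (hχ : IsChirp ψ χ) (a : R) : χ (-a) = χ a := by
  have h := hχ.map_add (-a) a
  rw [neg_add_cancel, hχ.map_zero, neg_mul, mul_assoc] at h
  have h' : χ a * (χ a * ψ (-(a * a))) = 1 := by
    rw [← mul_assoc, hχ.mul_self, ← AddChar.map_add_eq_mul, add_neg_cancel,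
      AddChar.map_zero_eq_one]
  exact mul_right_cancel₀ (right_ne_zero_of_mul_eq_one h') (h.symm.trans h'.symm)

variable [Fintype R]

theorem IsChirp.mul_sum_mul (hχ : IsChirp ψ χ) (k : R) :
    χ k * ∑ x, χ x * ψ (x * k) = ∑ x, χ x := by
  rw [Finset.mul_sum, ← Equiv.sum_comp (Equiv.addRight k) χ]
  refine Finset.sum_congr rfl fun x _ => ?_
  rw [Equiv.coe_addRight, hχ.map_add]
  ring

theorem IsChirp.sum_mul_mul (hχ : IsChirp ψ χ) (a b : R) :
    ∑ x, χ a * ψ (a * x) * χ x * ψ (x * b) * χ b = (∑ x, χ x) * ψ (-(a * b)) := by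
  have hsum : ∑ x, χ a * ψ (a * x) * χ x * ψ (x * b) * χ b =
      χ a * χ b * ∑ x, χ x * ψ (x * (a + b)) := by
    rw [Finset.mul_sum]
    refine Finset.sum_congr rfl fun x _ => ?_
    rw [mul_add, AddChar.map_add_eq_mul, mul_comm a x]
    ring
  have hψ : ψ (a * b) * ψ (-(a * b)) = 1 := by
    rw [← AddChar.map_add_eq_mul, add_neg_cancel, AddChar.map_zero_eq_one]
  rw [hsum, ← hχ.mul_sum_mul (a + b), hχ.map_add]
  linear_combination (-χ a * χ b * ∑ x, χ x * ψ (x * (a + b))) * hψ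

variable [DecidableEq R]

theorem fourierMatrix_mul_fourierMatrix_inv (hψ : ψ.IsPrimitive) :
    fourierMatrix ψ * fourierMatrix ψ⁻¹ = (Fintype.card R : K) • 1 := by
  ext a b
  have hmul (x : R) : ψ (a * x) * ψ⁻¹ (x * b) = ψ (x * (a - b)) := by
    rw [AddChar.inv_apply, ← AddChar.map_add_eq_mul]
    ring_nf
  simp only [fourierMatrix_apply, mul_apply, hmul, AddChar.sum_mulShift _ hψ, sub_eq_zero,
    Matrix.smul_apply, one_apply, smul_eq_mul, mul_ite, mul_one, mul_zero,
    Nat.cast_ite, Nat.cast_zero]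

theorem sign_neg_mul_det_fourierMatrix_sq (hψ : ψ.IsPrimitive) :
    (Equiv.Perm.sign (Equiv.neg R) : K) * (fourierMatrix ψ).det ^ 2 =
      (Fintype.card R : K) ^ Fintype.card R := by
  have h := congrArg det (fourierMatrix_mul_fourierMatrix_inv hψ)
  rw [det_mul, fourierMatrix_inv, det_permute, det_smul, det_one, mul_one] at h
  rw [← h]
  ring

theorem IsChirp.diagonal_mul_fourierMatrix (hχ : IsChirp ψ χ) :
    diagonal χ * fourierMatrix ψ * diagonal χ * fourierMatrix ψ * diagonal χ =
      (∑ x, χ x) • fourierMatrix ψ⁻¹ := by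
  ext a b
  rw [mul_diagonal, mul_apply, Finset.sum_mul]
  simp only [mul_diagonal, diagonal_mul, fourierMatrix_apply, Matrix.smul_apply,
    smul_eq_mul, AddChar.inv_apply]
  exact hχ.sum_mul_mul a b

theorem IsChirp.diagonal_mul_fourierMatrix_inv (hχ : IsChirp ψ χ) :
    diagonal χ * fourierMatrix ψ * diagonal χ * fourierMatrix ψ⁻¹ * diagonal χ =
      (∑ x, χ x) • fourierMatrix ψ := by
  ext a b
  rw [mul_diagonal, mul_apply, Finset.sum_mul]
  simp only [mul_diagonal, diagonal_mul, fourierMatrix_apply, Matrix.smul_apply,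
    smul_eq_mul, AddChar.inv_apply]
  simpa only [hχ.map_neg, mul_neg, neg_neg] using hχ.sum_mul_mul a (-b)

theorem IsChirp.diagonal_mul_diagonal (hχ : IsChirp ψ χ) :
    diagonal χ * diagonal χ = diagonal fun a => ψ (a * a) := by
  simp only [Matrix.diagonal_mul_diagonal, hχ.mul_self]

/-- The Fourier matrix of `ψ` followed by multiplication by the quadratic character
`a ↦ ψ (a ^ 2)`. -/
def quadraticFourierMatrix (ψ : AddChar R K) : Matrix R R K :=
  diagonal (fun a => ψ (a * a)) * fourierMatrix ψ

theorem IsChirp.quadraticFourierMatrix_sq_mul (hχ : IsChirp ψ χ) :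
    quadraticFourierMatrix ψ ^ 2 * (diagonal χ * fourierMatrix ψ) * diagonal (fun a => ψ (a * a)) =
      (∑ x, χ x) ^ 2 • (diagonal χ * fourierMatrix ψ) := by
  rw [quadraticFourierMatrix, ← hχ.diagonal_mul_diagonal]
  set D := diagonal χ
  set F := fourierMatrix ψ
  calc (D * D * F) ^ 2 * (D * F) * (D * D)
      = D * D * F * D * (D * F * D * F * D) * D := by simp only [pow_two, Matrix.mul_assoc]
    _ = (∑ x, χ x) • (D * (D * F * D * fourierMatrix ψ⁻¹ * D)) := by
        rw [hχ.diagonal_mul_fourierMatrix]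
        simp only [Matrix.mul_smul, smul_mul, Matrix.mul_assoc]
    _ = (∑ x, χ x) ^ 2 • (D * F) := by
        rw [hχ.diagonal_mul_fourierMatrix_inv, Matrix.mul_smul, smul_smul, pow_two]

theorem IsChirp.quadraticFourierMatrix_pow_mul (hχ : IsChirp ψ χ) (n : ℕ) :
    quadraticFourierMatrix ψ ^ (2 * n) * (diagonal χ * fourierMatrix ψ) *
        diagonal (fun a => ψ (a * a)) ^ n =
      (∑ x, χ x) ^ (2 * n) • (diagonal χ * fourierMatrix ψ) := by
  induction n with
  | zero => simp only [mul_zero, pow_zero, Matrix.one_mul, Matrix.mul_one, one_smul]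
  | succ n ih =>
    have hsq := hχ.quadraticFourierMatrix_sq_mul
    set E := diagonal fun a => ψ (a * a)
    set W := quadraticFourierMatrix ψ
    set P := diagonal χ * fourierMatrix ψ
    rw [Nat.mul_succ, pow_add W (2 * n) 2, pow_add (∑ x, χ x) (2 * n) 2, pow_succ' E]
    calc W ^ (2 * n) * W ^ 2 * P * (E * E ^ n)
        = W ^ (2 * n) * (W ^ 2 * P * E) * E ^ n := by simp only [Matrix.mul_assoc]
      _ = ((∑ x, χ x) ^ (2 * n) * (∑ x, χ x) ^ 2) • P := by
          rw [hsq, Matrix.mul_smul, smul_mul, ih, smul_smul, mul_comm]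

variable [NeZero (Fintype.card R : K)]

theorem det_fourierMatrix_ne_zero (hψ : ψ.IsPrimitive) : (fourierMatrix ψ).det ≠ 0 := by
  intro h
  have := sign_neg_mul_det_fourierMatrix_sq hψ
  rw [h, zero_pow two_ne_zero, mul_zero] at this
  exact pow_ne_zero _ (NeZero.ne _) this.symm

theorem IsChirp.det_diagonal_mul_fourierMatrix_ne_zero (hχ : IsChirp ψ χ) (hψ : ψ.IsPrimitive) :
    (diagonal χ * fourierMatrix ψ).det ≠ 0 := by
  rw [det_mul, det_diagonal]
  exact mul_ne_zero (Finset.prod_ne_zero_iff.2 fun a _ => hχ.ne_zero a)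
    (det_fourierMatrix_ne_zero hψ)

theorem IsChirp.quadraticFourierMatrix_pow (hχ : IsChirp ψ χ) (hψ : ψ.IsPrimitive) {n : ℕ}
    (hn : (n : R) = 0) :
    quadraticFourierMatrix ψ ^ (2 * n) = (∑ x, χ x) ^ (2 * n) • 1 := by
  have hE : diagonal (fun a => ψ (a * a)) ^ n = 1 := by
    rw [diagonal_pow, ← diagonal_one]
    congr 1
    ext a
    rw [Pi.pow_apply, ← AddChar.map_nsmul_eq_pow, nsmul_eq_mul, hn, zero_mul,
      AddChar.map_zero_eq_one]
  have hP : IsUnit (diagonal χ * fourierMatrix ψ) :=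
    (isUnit_iff_isUnit_det _).2 (hχ.det_diagonal_mul_fourierMatrix_ne_zero hψ).isUnit
  have h := hχ.quadraticFourierMatrix_pow_mul n
  rw [hE, Matrix.mul_one] at h
  refine hP.mul_right_cancel ?_
  rw [h, smul_mul, Matrix.one_mul]

theorem IsChirp.sum_pow (hχ : IsChirp ψ χ) (hψ : ψ.IsPrimitive) :
    (∑ x, χ x) ^ (2 * Fintype.card R) =
      (∏ x, χ x) ^ 6 * Equiv.Perm.sign (Equiv.neg R) * (Fintype.card R : K) ^ Fintype.card R := by
  have hdet := congrArg det hχ.quadraticFourierMatrix_sq_mul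
  rw [quadraticFourierMatrix, ← hχ.diagonal_mul_diagonal, det_smul, det_mul, det_mul, det_pow,
    ← pow_mul] at hdet
  refine mul_right_cancel₀ (hχ.det_diagonal_mul_fourierMatrix_ne_zero hψ) (hdet.symm.trans ?_)
  have hsign : (Equiv.Perm.sign (Equiv.neg R) : K) ^ 2 = 1 := by
    exact_mod_cast congrArg (Int.cast (R := K)) (Int.isUnit_sq (Equiv.Perm.sign _).isUnit)
  rw [← sign_neg_mul_det_fourierMatrix_sq hψ]
  simp only [det_mul, det_diagonal]
  linear_combination (-(∏ x, χ x) ^ 7 * (fourierMatrix ψ).det ^ 3) * hsign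

end Chirp

section ZModChirp

variable (d : ℕ)

/-- The square root `-exp (πi/d)` of `ω`. The sign makes `n ↦ chirpRoot d ^ n ^ 2` periodic modulo
`d` for odd `d` as well. -/
noncomputable def chirpRoot : ℂ := Complex.exp (Real.pi * Complex.I * (d + 1) / d)

variable {d} in
/-- The chirp of the standard additive character of `ZMod d`. -/
noncomputable def chirp (a : ZMod d) : ℂ := chirpRoot d ^ a.val ^ 2

variable [NeZero d]

theorem omega_pow (n : ℕ) : omega d ^ n = stdAddChar (n : ZMod d) := by
  rw [← Int.cast_natCast n, stdAddChar_coe, omega, ← Complex.exp_nat_mul, Int.cast_natCast]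
  ring_nf

theorem chirpRoot_sq : chirpRoot d ^ 2 = omega d := by
  have hd : (d : ℂ) ≠ 0 := NeZero.ne _
  have h : ((2 : ℕ) : ℂ) * (Real.pi * Complex.I * (d + 1) / d) =
      2 * Real.pi * Complex.I / d + 2 * Real.pi * Complex.I := by
    field_simp
    push_cast
    ring
  rw [chirpRoot, omega, ← Complex.exp_nat_mul, h, Complex.exp_periodic]

theorem chirpRoot_pow_self : chirpRoot d ^ d = (-1) ^ (d + 1) := by
  have hd : (d : ℂ) ≠ 0 := NeZero.ne _
  rw [chirpRoot, ← Complex.exp_nat_mul, ← Complex.exp_pi_mul_I, ← Complex.exp_nat_mul]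
  congr 1
  push_cast
  field_simp

theorem chirp_natCast (n : ℕ) : chirp (n : ZMod d) = chirpRoot d ^ n ^ 2 := by
  set r := n % d
  set q := n / d
  have hn : n ^ 2 = r ^ 2 + d * (q * (2 * r + d * q)) := by
    rw [← Nat.mod_add_div n d]
    ring
  have heven : Even ((d + 1) * (q * (2 * r + d * q))) := by
    grind
  rw [chirp, val_natCast, hn, pow_add, pow_mul _ d, chirpRoot_pow_self, ← pow_mul,
    heven.neg_one_pow, mul_one]

theorem isChirp_chirp : IsChirp stdAddChar (chirp (d := d)) where
  map_add a b := by
    obtain ⟨m, rfl⟩ := natCast_zmod_surjective a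
    obtain ⟨n, rfl⟩ := natCast_zmod_surjective b
    rw [← Nat.cast_add, ← Nat.cast_mul, chirp_natCast, chirp_natCast, chirp_natCast, ← omega_pow,
      ← chirpRoot_sq]
    ring
  mul_self a := by
    obtain ⟨n, rfl⟩ := natCast_zmod_surjective a
    rw [← Nat.cast_mul, chirp_natCast, ← omega_pow, ← chirpRoot_sq]
    ring

theorem six_mul_sum_range_succ_sq (n : ℕ) :
    6 * ∑ i ∈ Finset.range (n + 1), i ^ 2 = n * (n + 1) * (2 * n + 1) := by
  induction n with
  | zero => rfl
  | succ n ih =>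
    rw [Finset.sum_range_succ, mul_add, ih]
    ring

theorem prod_chirp_pow_six : (∏ a : ZMod d, chirp a) ^ 6 = (-1) ^ (d + 1) := by
  obtain ⟨n, rfl⟩ := Nat.exists_eq_succ_of_ne_zero (NeZero.ne d)
  have hsum : 6 * ∑ a : ZMod (n + 1), a.val ^ 2 = n * (n + 1) * (2 * n + 1) :=
    (congrArg (6 * ·) (Fin.sum_univ_eq_sum_range (· ^ 2) (n + 1))).trans
      (six_mul_sum_range_succ_sq n)
  simp only [chirp]
  rw [Finset.prod_pow_eq_pow_sum, ← pow_mul', hsum, mul_right_comm, pow_mul', chirpRoot_pow_self,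
    ← pow_mul]
  exact neg_one_pow_congr (by grind)

theorem card_fixedPoints_neg :
    Fintype.card (Function.fixedPoints (Equiv.neg (ZMod d))) = 2 - d % 2 := by
  have hd : 0 < d := NeZero.pos d
  let S : Finset (ZMod d) := {a | a = 0 ∨ 2 * a.val = d}
  have hcard : Fintype.card (Function.fixedPoints (Equiv.neg (ZMod d))) = S.card :=
    Fintype.card_of_subtype S fun a => by
      simp only [S, Finset.mem_filter_univ]
      exact (ZMod.neg_eq_self_iff a).symm
  rw [hcard]
  rcases Nat.even_or_odd' d with ⟨m, hm | hm⟩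
  · have hval : (m : ZMod d).val = m := val_natCast_of_lt (by omega)
    have hS : S = {0, (m : ZMod d)} := by
      ext a
      have hhalf : 2 * a.val = d ↔ a = m := by
        rw [← (val_injective d).eq_iff, hval]
        omega
      simp only [S, Finset.mem_filter_univ, hhalf, Finset.mem_insert, Finset.mem_singleton]
    have hne : (0 : ZMod d) ≠ m := by
      rw [← (val_injective d).ne_iff, hval, val_zero]
      omega
    rw [hS, Finset.card_pair hne]
    omega
  · have hS : S = {0} := by
      ext a
      simp only [S, Finset.mem_filter_univ, Finset.mem_singleton]
      exact or_iff_left (by omega)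
    rw [hS, Finset.card_singleton]
    omega

theorem sign_neg : Equiv.Perm.sign (Equiv.neg (ZMod d)) = (-1) ^ ((d - 1) / 2) := by
  have hsq : Equiv.neg (ZMod d) ^ 2 = 1 := by
    ext a
    simp [pow_two]
  rw [Equiv.Perm.sign_of_pow_two_eq_one hsq, card_fixedPoints_neg, ZMod.card]
  congr 1
  omega

theorem sum_chirp_pow :
    (∑ a : ZMod d, chirp a) ^ (2 * d) = (-1) ^ (d * (d - 1) / 2) * (d : ℂ) ^ d := by
  have hd : 0 < d := NeZero.pos d
  have hcard : NeZero (Fintype.card (ZMod d) : ℂ) := by rw [ZMod.card]; infer_instance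
  have h := (isChirp_chirp d).sum_pow (isPrimitive_stdAddChar d)
  rw [prod_chirp_pow_six, sign_neg, ZMod.card] at h
  push_cast at h
  rw [h, ← pow_add]
  clear h hcard
  congr 1
  refine neg_one_pow_congr ?_
  rcases Nat.even_or_odd' d with ⟨m, hm | hm⟩
  · have hhalf : d * (d - 1) / 2 = m * (d - 1) := by
      rw [hm, mul_assoc, Nat.mul_div_cancel_left _ two_pos]
    grind
  · have hhalf : d * (d - 1) / 2 = d * m := by
      rw [show d - 1 = 2 * m by omega, mul_left_comm, Nat.mul_div_cancel_left _ two_pos]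
    grind

end ZModChirp

section Reconstruction

variable (d : ℕ) [NeZero d]

theorem shift_pow_apply (n : ℕ) (a b : ZMod d) :
    (shift d ^ n) a b = if a = b + n then 1 else 0 := by
  induction n generalizing b with
  | zero => simp only [pow_zero, one_apply, Nat.cast_zero, add_zero]
  | succ n ih =>
    rw [pow_succ, mul_apply]
    simp only [shift, of_apply, mul_ite, mul_one, mul_zero, Finset.sum_ite_eq', Finset.mem_univ,
      if_true, Nat.cast_succ]
    rw [← shift, ih, add_assoc, add_comm 1]

theorem rho_apply (j k a b : ZMod d) :
    rho d (j, k) a b = if a = b + j then stdAddChar (k * b) else 0 := by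
  rw [rho, modulation, diagonal_pow, mul_diagonal, shift_pow_apply, Pi.pow_apply, ← pow_mul,
    omega_pow, Nat.cast_mul, natCast_zmod_val, natCast_zmod_val, natCast_zmod_val, ite_mul,
    one_mul, zero_mul, mul_comm]

variable {d} (c : Matrix (ZMod d) (ZMod d) ℂ)

local notation "F" => fourierMatrix (stdAddChar (N := d))

theorem reconstruction_apply (a b : ZMod d) :
    reconstruction d c a b = (d : ℂ)⁻¹ * (c * F : Matrix _ _ ℂ) (b - a) (-a) := by
  change ((1 / (d : ℂ)) • ∑ j : ZMod d, ∑ k : ZMod d, c j k • (rho d (j, k))ᴴ) a b = _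
  simp only [Matrix.smul_apply, Matrix.sum_apply, conjTranspose_apply, rho_apply, smul_eq_mul,
    mul_apply, fourierMatrix_apply, one_div]
  congr 1
  rw [Finset.sum_eq_single (b - a)]
  · simp [AddChar.map_neg_eq_conj]
  · intro j _ hj
    refine Finset.sum_eq_zero fun k _ => ?_
    rw [if_neg fun h => hj (sub_eq_iff_eq_add'.2 h).symm, star_zero, mul_zero]
  · exact fun h => absurd (Finset.mem_univ _) h

theorem reconstruction_sq_apply (a b : ZMod d) :
    (reconstruction d ^ 2) c a b =
      (d : ℂ)⁻¹ ^ 2 * (stdAddChar (a * a - a * b) * (F * c * F : Matrix _ _ ℂ) (-a) (a - b)) := by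
  rw [pow_two, Module.End.mul_apply, reconstruction_apply, mul_apply, Matrix.mul_assoc, mul_apply,
    ← Equiv.sum_comp (Equiv.addRight (b - a)), pow_two, mul_assoc]
  congr 1
  rw [Finset.mul_sum, Finset.mul_sum]
  refine Finset.sum_congr rfl fun p _ => ?_
  have hchar : stdAddChar ((p + (b - a)) * -a) =
      stdAddChar (a * a - a * b) * stdAddChar (-a * p) := by
    rw [← AddChar.map_add_eq_mul]
    ring_nf
  rw [reconstruction_apply, Equiv.coe_addRight, add_sub_cancel_right, neg_sub]
  simp only [fourierMatrix_apply, hchar]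
  ring

theorem reconstruction_cube_apply (a b : ZMod d) :
    (reconstruction d ^ 3) c a b =
      (d : ℂ)⁻¹ ^ 2 * (stdAddChar (a * a - a * b) * (F * c : Matrix _ _ ℂ) (a - b) (-b)) := by
  have hd : (d : ℂ) ≠ 0 := NeZero.ne _
  have hinv : (F * c * F * fourierMatrix stdAddChar⁻¹ : Matrix _ _ ℂ) (a - b) (-b) =
      d * (F * c : Matrix _ _ ℂ) (a - b) (-b) := by
    rw [Matrix.mul_assoc, fourierMatrix_mul_fourierMatrix_inv (isPrimitive_stdAddChar d),
      mul_smul_one, ZMod.card, Matrix.smul_apply, smul_eq_mul]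
  have hchar (q : ZMod d) :
      stdAddChar ((b - a) * (b - a) - (b - a) * (b - a - q)) * stdAddChar ((b - a - q) * -a) =
        stdAddChar (a * a - a * b) * stdAddChar⁻¹ (q * -b) := by
    rw [AddChar.inv_apply, ← AddChar.map_add_eq_mul, ← AddChar.map_add_eq_mul]
    ring_nf
  have hsum : (reconstruction d ^ 3) c a b = (d : ℂ)⁻¹ ^ 3 * (stdAddChar (a * a - a * b) *
      (F * c * F * fourierMatrix stdAddChar⁻¹ : Matrix _ _ ℂ) (a - b) (-b)) := by
    rw [pow_succ', Module.End.mul_apply, reconstruction_apply, mul_apply,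
      mul_apply (M := F * c * F), ← Equiv.sum_comp (Equiv.subLeft (b - a)), Finset.mul_sum,
      Finset.mul_sum, Finset.mul_sum]
    refine Finset.sum_congr rfl fun q _ => ?_
    rw [reconstruction_sq_apply, Equiv.subLeft_apply, neg_sub, sub_sub_cancel]
    simp only [fourierMatrix_apply]
    linear_combination (d : ℂ)⁻¹ ^ 3 * (F * c * F : Matrix _ _ ℂ) (a - b) q * hchar q
  rw [hsum, hinv]
  field_simp

theorem hadamard_reconstruction_cube :
    F ⊙ (reconstruction d ^ 3) c =
      (d : ℂ)⁻¹ ^ 2 • (quadraticFourierMatrix stdAddChar * (F ⊙ c)).submatrix id Neg.neg := by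
  ext a b
  simp only [hadamard_apply, reconstruction_cube_apply, Matrix.smul_apply, submatrix_apply, id,
    quadraticFourierMatrix, Matrix.mul_assoc, diagonal_mul, smul_eq_mul]
  have hleft : F a b * stdAddChar (a * a - a * b) = stdAddChar (a * a) := by
    rw [fourierMatrix_apply, ← AddChar.map_add_eq_mul, add_sub_cancel]
  have hright : (F * c : Matrix _ _ ℂ) (a - b) (-b) = (F * (F ⊙ c) : Matrix _ _ ℂ) a (-b) := by
    simp only [mul_apply, hadamard_apply, fourierMatrix_apply, ← mul_assoc,
      ← AddChar.map_add_eq_mul]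
    refine Finset.sum_congr rfl fun p _ => ?_
    ring_nf
  rw [hright, ← hleft]
  ring

theorem hadamard_reconstruction_pow_six :
    F ⊙ (reconstruction d ^ 6) c =
      (d : ℂ)⁻¹ ^ 4 • (quadraticFourierMatrix stdAddChar ^ 2 * (F ⊙ c)) := by
  have hmul (A B : Matrix (ZMod d) (ZMod d) ℂ) :
      A * B.submatrix id Neg.neg = (A * B).submatrix id Neg.neg := rfl
  rw [show 6 = 3 + 3 from rfl, pow_add, Module.End.mul_apply, hadamard_reconstruction_cube,
    hadamard_reconstruction_cube, Matrix.mul_smul, hmul, pow_two (quadraticFourierMatrix _),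
    Matrix.mul_assoc, submatrix_smul, Pi.smul_apply, Pi.smul_apply, smul_smul, ← pow_add,
    submatrix_submatrix]
  simp

theorem hadamard_reconstruction_pow_six_mul (n : ℕ) :
    F ⊙ (reconstruction d ^ (6 * n)) c =
      (d : ℂ)⁻¹ ^ (4 * n) • (quadraticFourierMatrix stdAddChar ^ (2 * n) * (F ⊙ c)) := by
  induction n with
  | zero => simp
  | succ n ih =>
    rw [Nat.mul_succ, add_comm, pow_add, Module.End.mul_apply, hadamard_reconstruction_pow_six, ih,
      Matrix.mul_smul, smul_smul, ← Matrix.mul_assoc, ← pow_add, ← pow_add]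
    ring_nf

theorem hadamard_fourierMatrix_injective :
    Function.Injective (F ⊙ · : Matrix (ZMod d) (ZMod d) ℂ → Matrix (ZMod d) (ZMod d) ℂ) :=
  fun _ _ h => ext fun a b =>
    mul_left_cancel₀ (stdAddChar.val_isUnit (a * b)).ne_zero (congrFun₂ h a b)

variable (d)

theorem reconstruction_pow :
    reconstruction d ^ (6 * d) =
      ((-1) ^ (d * (d - 1) / 2) * (d : ℂ)⁻¹ ^ (3 * d)) • (1 : Module.End ℂ _) := by
  have hd : (d : ℂ) ≠ 0 := NeZero.ne _
  have hcard : NeZero (Fintype.card (ZMod d) : ℂ) := by rw [ZMod.card]; infer_instance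
  refine LinearMap.ext fun c => hadamard_fourierMatrix_injective ?_
  dsimp only
  rw [hadamard_reconstruction_pow_six_mul, (isChirp_chirp d).quadraticFourierMatrix_pow
    (isPrimitive_stdAddChar d) (natCast_self d), sum_chirp_pow, smul_mul, Matrix.one_mul, smul_smul,
    LinearMap.smul_apply, Module.End.one_apply, hadamard_smul]
  congr 1
  rw [show 4 * d = 3 * d + d by ring, pow_add, mul_left_comm, mul_assoc, ← mul_pow _ _ d,
    inv_mul_cancel₀ hd, one_pow, mul_one]

theorem sqrt_smul_reconstruction_pow :
    ((Real.sqrt d : ℂ) • reconstruction d) ^ (6 * d) =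
      (-1 : ℂ) ^ (d * (d - 1) / 2) • (1 : Module.End ℂ _) := by
  have hd : (d : ℂ) ≠ 0 := NeZero.ne _
  have hsqrt : (Real.sqrt d : ℂ) ^ (6 * d) = (d : ℂ) ^ (3 * d) := by
    rw [show 6 * d = 2 * (3 * d) by ring, pow_mul, ← Complex.ofReal_pow,
      Real.sq_sqrt (Nat.cast_nonneg d), Complex.ofReal_natCast]
  rw [smul_pow, reconstruction_pow, smul_smul, hsqrt, inv_pow]
  congr 1
  field_simp

end Reconstruction

end WeylHeisenberg

theorem theorem3p2 (d : ℕ) [NeZero d] (hd : 2 ≤ d) :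
    IsOfFinOrder ((Real.sqrt d : ℂ) • WeylHeisenberg.reconstruction d) ∧
    ((Real.sqrt d : ℂ) • WeylHeisenberg.reconstruction d) ^ (6 * d) =
      ((-1 : ℂ) ^ (d * (d - 1) / 2)) •
        (1 : Module.End ℂ (Matrix (ZMod d) (ZMod d) ℂ)) := by
  have hpow := WeylHeisenberg.sqrt_smul_reconstruction_pow d
  refine ⟨isOfFinOrder_iff_pow_eq_one.2 ⟨6 * d * 2, by omega, ?_⟩, hpow⟩
  rw [pow_mul, hpow, smul_pow, one_pow, pow_right_comm, neg_one_sq, one_pow, one_smul]
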